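/- Setting. Let $A$ be a set of visible actions, $\tau\notin A$ and $A_\tau=A\cup\{\tau\}$. Let $\Sigma$ be a signature of operators of finite arity; write $\Sigma X=\coprod_o X^{\mathrm{ar}(o)}$ also for its polynomial functor on $\mathbf{Set}$, and $\Sigma^*X$ for the set of terms over $X$ (the free monad, with multiplication $\mu^{\Sigma}$). Let $TX=\mathcal P_c(A_\tau\times X)$ (countable subsets), with unit $\eta(x)=\{(\tau,x)\}$ and multiplication $$\mu(W)=\{(\delta_1\cdot\delta_2,x)\mid (\delta_1,V)\in W,\ (\delta_2,x)\in V,\ \delta_1=\tau\text{ or }\delta_2=\tau\},\qquad \delta\cdot\tau=\tau\cdot\delta=\delta .$$ Let $\diamond$ be Kleisli composition for $T$. Maps $X\to TY$ are ordered pointwise by inclusion, so joins are pointwise unions. For $\alpha:X\to TX$ let $\alpha^*=\bigvee_{n<\omega}(\eta_X\vee\alpha)^{n}$ (powers for $\diamond$). A GSOS rule for an $n$-ary operator $o$ has the form $$\frac{\{x_{i_k}\xrightarrow{c_k}y_k\}_{k\in K}\qquad \{x_{j_l}\not\xrightarrow{d_l}\}_{l\in M}}{o(x_1,\dots,x_n)\xrightarrow{\alpha}t}$$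 with $K,M$ finite, $c_k,d_l,\alpha\in A_\tau$, with $x_1,\dots,x_n$ and the $y_k$ pairwise distinct variables, and with $t$ a term over these variables. A GSOS language $\mathcal L$ is a set of such rules such that, for every operator $o$ and all countable $E_1,\dots,E_n\subseteq A_\tau$, only countably many rules of $o$ satisfy $c_k\in E_{i_k}$ for all $k$ and $d_l\notin E_{j_l}$ for all $l$. It induces the GSOS law $\rho_X:\Sigma(X\times TX)\to T\Sigma^*X$, where $\rho_X(o,(x_i,W_i)_i)$ is the set of all pairs $(\alpha,t[x_i,y_k])$ given by a rule of $o$ as above and elements $y_k$ with $(c_k,y_k)\in W_{i_k}$ for all $k$ and $(d_l,z)\notin W_{j_l}$ for all $l$ and $z$. The corresponding $\lambda_X:\Sigma^*(X\times TX)\to T\Sigma^*X$ is given by structural recursion: $\lambda(x,W)=T\eta^{\Sigma}(W)$ on variables, and $\lambda(o(s_1,\dots,s_n))=T\mu^{\Sigma}\big(\rho_{\Sigma^*X}(o,(\Sigma^*\pi_1(s_i),\lambda(s_i))_i)\big)$. Write $\overline{\Sigma}f=\lambda_X\circ\Sigma^*\langle\mathrm{id},f\rangle:\Sigma^*X\to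 T\Sigma^*X$ for $f:X\to TX$. The language $\mathcal L$ is *simply WB cool* if it is positive (no rule has negative premises) and: 1. all operators are straight: in no rule does a variable occur more than once in the left-hand sides of the premises; 2. the only rules with a premise labelled $\tau$ are patience rules, i.e. rules $\dfrac{x_i\xrightarrow{\tau}y}{o(x_1,\dots,x_n)\xrightarrow{\tau}o(x_1,\dots,x_n)[y/x_i]}$ (the patience rule for the $i$th argument of $o$); 3. every active argument has a patience rule, where the $i$th argument of $o$ is active if $x_i$ is the left-hand side of a premise in some rule of $o$; 4. every receiving argument has a patience rule, where the $i$th argument of $o$ is receiving if the target of some rule of $\mathcal L$ has a subterm $o(v_1,\dots,v_n)$ such that the right-hand side of a premise of that rule occurs in $v_i$; 5. all operators are smooth: they are straight, and in no rule does a variable occur both in the target and in the left-hand side of a premise. Theorem. Let $\mathcal L$ be a simply WB cool GSOS language. Then its GSOS law satisfies the three compositionality criteria: - (Continuity) for every set $X$ and every ascending chain $f_0\le f_1\le\cdots:X\to TX$, $\ \overline{\Sigma}\big(\bigvee_i f_i\big)=\bigvee_i\overline{\Sigma}f_i$; - (Unitality) for every set $X$ and every $f:X\to TX$, $\ \overline{\Sigma}(\eta_X\vee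 f)\le(\overline{\Sigma}f)^*$; - (Observability) for every set $X$ and every $f:X\to TX$, $\ \overline{\Sigma}(f\diamond f)\le(\overline{\Sigma}f)^*$. -/

import Mathlib

universe u v w

/-! ### Signatures and terms -/

/-- A signature: operators, each of a finite arity. -/
structure Signature where
  Op : Type u
  arity : Op → ℕ

/-- The polynomial functor `Σ` of a signature on objects: an operator applied to arguments. -/
structure Signature.Layer (S : Signature.{u}) (X : Type v) where
  op : S.Op
  args : Fin (S.arity op) → X

/-- The action of the functor `Σ` on maps. -/
def Signature.Layer.map {S : Signature.{u}} {X : Type v} {Y : Type w} (g : X → Y)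
    (s : S.Layer X) : S.Layer Y :=
  ⟨s.op, fun i => g (s.args i)⟩

/-- Terms with variables in `V`, that is, the free monad `Σ*` on `V`. -/
inductive Term (S : Signature.{u}) (V : Type v) : Type (max u v)
  | var (x : V) : Term S V
  | op (o : S.Op) (args : Fin (S.arity o) → Term S V) : Term S V

namespace Term

variable {S : Signature.{u}}

/-- Simultaneous substitution. -/
def subst {V : Type v} {W : Type w} (g : V → Term S W) : Term S V → Term S W
  | var x => g x
  | op o args => op o (fun i => (args i).subst g)

/-- The action of the functor `Σ*` on maps (renaming of variables). -/
def map {V : Type v} {W : Type w} (g : V → W) (t : Term S V) : Term S W :=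
  t.subst (fun x => var (g x))

/-- The multiplication `Σ* Σ* → Σ*` (flattening of a term of terms). -/
def join {V : Type v} (t : Term S (Term S V)) : Term S V :=
  t.subst id

/-- The set of variables that occur in a term. -/
def vars {V : Type v} : Term S V → Set V
  | var x => {x}
  | op _ args => ⋃ i, (args i).vars

/-- `Subterm s t`: the term `s` is a (not necessarily proper) subterm of `t`. -/
inductive Subterm {V : Type v} (s : Term S V) : Term S V → Prop
  | refl : Subterm s s
  | arg (o : S.Op) (args : Fin (S.arity o) → Term S V) (i : Fin (S.arity o)) :
      Subterm s (args i) → Subterm s (op o args)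

theorem map_subst {V : Type v} {W : Type w} {Z : Type*} (g : V → Term S W) (h : W → Z)
    (t : Term S V) : (t.subst g).map h = t.subst (fun x => (g x).map h) := by
  induction t with
  | var x => rfl
  | op o args ih =>
    simp only [map, subst] at ih ⊢
    congr 1
    funext i
    exact ih i

theorem map_map {V : Type v} {W : Type w} {Z : Type*} (g : V → W) (h : W → Z)
    (t : Term S V) : (t.map g).map h = t.map (fun x => h (g x)) := by
  exact map_subst _ h t

end Term

/-! ### The behaviour monad

The labels are `Option A`: the visible actions `some a` and the internal action `none` (that is,
`τ`). The monad is `T X = P_c (Option A × X)`, the countable sets of labelled transitions. -/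

/-- `T X`: countable sets of pairs of a label and an element of `X`. -/
def Beh (A X : Type u) : Type u :=
  {W : Set (Option A × X) // W.Countable}

namespace Beh

variable {A X Y Z : Type u}

/-- The order is inclusion and the binary join is union. -/
instance : SemilatticeSup (Beh A X) :=
  Subtype.semilatticeSup (P := fun W : Set (Option A × X) => W.Countable)
    (fun _ _ h₁ h₂ => Set.Countable.union h₁ h₂)

/-- The action of the functor `T` on maps. -/
def map (g : X → Y) (W : Beh A X) : Beh A Y :=
  ⟨(fun p => (p.1, g p.2)) '' W.1, W.2.image _⟩

/-- The unit: a silent step to the point itself. -/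
def eta (x : X) : Beh A X :=
  ⟨{(none, x)}, Set.countable_singleton _⟩

/-- The labels of a two-step transition: silent steps are dropped, and two visible labels in a
row are not allowed. -/
def labelMul : Option A → Option A → Set (Option A)
  | δ, none => {δ}
  | none, some a => {some a}
  | some _, some _ => ∅

theorem labelMul_countable (δ₁ δ₂ : Option A) : (labelMul δ₁ δ₂).Countable := by
  cases δ₁ <;> cases δ₂ <;> simp [labelMul]

/-- The multiplication of the monad. -/
def mu (W : Beh A (Beh A X)) : Beh A X :=
  ⟨{p | ∃ q ∈ W.1, ∃ r ∈ q.2.1, p.1 ∈ labelMul q.1 r.1 ∧ p.2 = r.2}, by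
    have h : {p : Option A × X | ∃ q ∈ W.1, ∃ r ∈ q.2.1,
        p.1 ∈ labelMul q.1 r.1 ∧ p.2 = r.2} ⊆
        ⋃ q ∈ W.1, ⋃ r ∈ q.2.1, (fun δ => (δ, r.2)) '' labelMul q.1 r.1 := by
      rintro ⟨δ, x⟩ ⟨q, hq, r, hr, h₁, h₂⟩
      simp only [Set.mem_iUnion]
      exact ⟨q, hq, r, hr, δ, h₁, Prod.ext rfl h₂.symm⟩
    refine Set.Countable.mono h ?_
    refine W.2.biUnion fun q _ => q.2.2.biUnion fun r _ => ?_
    exact (labelMul_countable _ _).image _⟩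

/-- Composition `g ⋄ f` in the Kleisli category of `T`. -/
def kcomp (g : Y → Beh A Z) (f : X → Beh A Y) : X → Beh A Z :=
  fun x => mu (map g (f x))

/-- Iterated Kleisli composition of an endomorphism. -/
def kpow (f : X → Beh A X) : ℕ → X → Beh A X
  | 0 => eta
  | n + 1 => kcomp (kpow f n) f

/-- The join `⋁ i, f i` of a sequence in a hom-set of the Kleisli category. -/
def seqSup (f : ℕ → X → Beh A Y) : X → Beh A Y :=
  fun x => ⟨⋃ i, (f i x).1, Set.countable_iUnion fun i => (f i x).2⟩

/-- `seqSup f` is indeed the supremum for the pointwise order. -/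
theorem isLUB_seqSup (f : ℕ → X → Beh A Y) : IsLUB (Set.range f) (seqSup f) := by
  constructor
  · rintro _ ⟨i, rfl⟩ x
    exact Set.subset_iUnion (fun i => (f i x).1) i
  · intro g hg x
    exact Set.iUnion_subset fun i => hg ⟨i, rfl⟩ x

/-- The reflexive transitive closure (free monad) `f* = ⋁ n, (id ∨ f)ⁿ` of an endomorphism `f`
of the Kleisli category. -/
def rtClosure (f : X → Beh A X) : X → Beh A X :=
  seqSup fun n => kpow (eta ⊔ f) n

end Beh

/-! ### GSOS laws and the three criteria -/

/-- A GSOS law of `Σ` over `T`: a natural transformation `Σ (Id × T) → T Σ*`. -/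
structure GSOSLaw (S : Signature.{u}) (A : Type u) where
  rho : ∀ {X : Type u}, S.Layer (X × Beh A X) → Beh A (Term S X)
  natural : ∀ {X Y : Type u} (g : X → Y) (s : S.Layer (X × Beh A X)),
    rho (s.map (Prod.map g (Beh.map g))) = Beh.map (Term.map g) (rho s)

namespace GSOSLaw

variable {S : Signature.{u}} {A : Type u} (law : GSOSLaw S A)

/-- The natural transformation `Σ* (Id × T) → T Σ*` that corresponds to a GSOS law, by structural
recursion. -/
def lam {X : Type u} : Term S (X × Beh A X) → Beh A (Term S X)
  | .var p => p.2.map Term.var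
  | .op o args =>
      (law.rho ⟨o, fun i => ((args i).map Prod.fst, lam (args i))⟩).map Term.join

/-- The composite of `Σ* ⟨id, f⟩` and the transformation `Σ* (Id × T) → T Σ*`. -/
def lift {X : Type u} (f : X → Beh A X) : Term S X → Beh A (Term S X) :=
  fun t => law.lam (t.map fun x => (x, f x))

/-- Continuity. -/
def Continuity : Prop :=
  ∀ (X : Type u) (f : ℕ → X → Beh A X), Monotone f →
    law.lift (Beh.seqSup f) = Beh.seqSup fun i => law.lift (f i)

/-- Unitality. -/
def Unitality : Prop :=
  ∀ (X : Type u) (f : X → Beh A X),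
    law.lift (Beh.eta ⊔ f) ≤ Beh.rtClosure (law.lift f)

/-- Observability. -/
def Observability : Prop :=
  ∀ (X : Type u) (f : X → Beh A X),
    law.lift (Beh.kcomp f f) ≤ Beh.rtClosure (law.lift f)

end GSOSLaw

/-! ### GSOS languages -/

/-- A GSOS rule with source `o(x_1, …, x_n)`, up to the names of its variables. It has positive
premises `x_(posArg k) --posLab k--> y_k`, negative premises (`x_(negArg k)` has no
`negLab k`-transition), and the conclusion `o(x_1, …, x_n) --act--> target`. In the target,
`Sum.inl i` is the variable `x_i` and `Sum.inr k` is the variable `y_k`. -/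
structure GSOSRule (S : Signature.{u}) (A : Type u) (o : S.Op) where
  npos : ℕ
  posArg : Fin npos → Fin (S.arity o)
  posLab : Fin npos → Option A
  nneg : ℕ
  negArg : Fin nneg → Fin (S.arity o)
  negLab : Fin nneg → Option A
  act : Option A
  target : Term S (Fin (S.arity o) ⊕ Fin npos)

namespace GSOSRule

variable {S : Signature.{u}} {A : Type u} {o : S.Op}

/-- The argument on the left-hand side of a (positive or negative) premise. -/
def lhs (r : GSOSRule S A o) : Fin r.npos ⊕ Fin r.nneg → Fin (S.arity o) :=
  Sum.elim r.posArg r.negArg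

/-- The rule is triggered when the `i`-th argument has exactly the initial labels `E i`. -/
def Triggered (r : GSOSRule S A o) (E : Fin (S.arity o) → Set (Option A)) : Prop :=
  (∀ k, r.posLab k ∈ E (r.posArg k)) ∧ ∀ k, r.negLab k ∉ E (r.negArg k)

/-- The patience rule for the `i`-th argument of `o`: from `x_i --τ--> y` infer
`o(x_1, …, x_n) --τ--> o(x_1, …, x_n)[y/x_i]`. -/
def patience (S : Signature.{u}) (A : Type u) (o : S.Op) (i : Fin (S.arity o)) :
    GSOSRule S A o where
  npos := 1
  posArg := fun _ => i
  posLab := fun _ => none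
  nneg := 0
  negArg := Fin.elim0
  negLab := Fin.elim0
  act := none
  target := .op o fun j => if j = i then .var (Sum.inr 0) else .var (Sum.inl j)

end GSOSRule

/-- A GSOS language: a set of rules for each operator. When each argument of an operator has only
countably many initial labels, only countably many of its rules may be triggered; this is what
makes the transitions of a term countable whenever those of its arguments are. -/
structure GSOSLanguage (S : Signature.{u}) (A : Type u) where
  rules : ∀ o : S.Op, Set (GSOSRule S A o)
  countable : ∀ (o : S.Op) (E : Fin (S.arity o) → Set (Option A)), (∀ i, (E i).Countable) →
    {r ∈ rules o | r.Triggered E}.Countable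

namespace GSOSLanguage

variable {S : Signature.{u}} {A : Type u} (L : GSOSLanguage S A)

/-- The transitions that the rules derive for one operator applied to arguments, from the
arguments and their transitions. -/
def derive {X : Type u} (s : S.Layer (X × Beh A X)) : Set (Option A × Term S X) :=
  {p | ∃ r ∈ L.rules s.op, ∃ y : Fin r.npos → X,
    (∀ k, (r.posLab k, y k) ∈ (s.args (r.posArg k)).2.1) ∧
    (∀ k z, (r.negLab k, z) ∉ (s.args (r.negArg k)).2.1) ∧
    p = (r.act, r.target.map (Sum.elim (fun i => (s.args i).1) y))}

theorem derive_countable {X : Type u} (s : S.Layer (X × Beh A X)) : (L.derive s).Countable := by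
  have hE := L.countable s.op (fun i => Prod.fst '' (s.args i).2.1)
    (fun i => (s.args i).2.2.image _)
  refine Set.Countable.mono (s₂ := ⋃ r ∈ {r ∈ L.rules s.op | r.Triggered
    (fun i => Prod.fst '' (s.args i).2.1)},
    (fun y : Fin r.npos → X => (r.act, r.target.map (Sum.elim (fun i => (s.args i).1) y))) ''
      {y | ∀ k, y k ∈ Prod.snd '' (s.args (r.posArg k)).2.1}) ?_ ?_
  · rintro p ⟨r, hr, y, hy, hn, rfl⟩
    simp only [Set.mem_iUnion]
    refine ⟨r, ⟨hr, fun k => ⟨_, hy k, rfl⟩, ?_⟩, y, fun k => ⟨_, hy k, rfl⟩, rfl⟩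
    rintro k ⟨⟨δ, z⟩, hq, h⟩
    simp only at h
    subst h
    exact hn k z hq
  · refine hE.biUnion fun r _ => Set.Countable.image ?_ _
    have h := Set.countable_univ_pi
      (fun k : Fin r.npos => (s.args (r.posArg k)).2.2.image Prod.snd)
    refine h.mono ?_
    intro y hy k _
    exact hy k

/-- The GSOS law induced by the rules of a language. -/
def law : GSOSLaw S A where
  rho := fun s => ⟨L.derive s, L.derive_countable s⟩
  natural := by
    intro X Y g s
    apply Subtype.ext
    ext p
    constructor
    · rintro ⟨r, hr, y, hy, hn, rfl⟩
      choose q hq hqe using hy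
      have h₁ : ∀ k, (q k).1 = r.posLab k := fun k => congrArg Prod.fst (hqe k)
      have h₂ : ∀ k, g (q k).2 = y k := fun k => congrArg Prod.snd (hqe k)
      refine ⟨_, ⟨r, hr, fun k => (q k).2, fun k => ?_, fun k z hz => ?_, rfl⟩, ?_⟩
      · rw [← h₁ k]; exact hq k
      · exact hn k (g z) ⟨_, hz, rfl⟩
      · simp only [Term.map_map]
        congr 2
        funext v
        rcases v with i | k
        · rfl
        · exact h₂ k
    · rintro ⟨_, ⟨r, hr, y, hy, hn, rfl⟩, rfl⟩
      refine ⟨r, hr, fun k => g (y k), fun k => ⟨_, hy k, rfl⟩, ?_, ?_⟩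
      · rintro k z ⟨⟨δ, x⟩, hq, h⟩
        have h' : δ = r.negLab k := congrArg Prod.fst h
        subst h'
        exact hn k x hq
      · simp only [Term.map_map]
        congr 2
        funext v
        rcases v with i | k <;> rfl

/-- No rule has a negative premise. -/
def Positive : Prop :=
  ∀ o, ∀ r ∈ L.rules o, r.nneg = 0

/-- An operator is straight if in none of its rules a variable occurs multiple times in the
left-hand sides of the premises. -/
def Straight (o : S.Op) : Prop :=
  ∀ r ∈ L.rules o, Function.Injective r.lhs

/-- An operator is smooth if it is straight and in none of its rules a variable occurs both in
the target and in the left-hand side of a premise. -/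
def Smooth (o : S.Op) : Prop :=
  L.Straight o ∧ ∀ r ∈ L.rules o, ∀ k, Sum.inl (r.lhs k) ∉ r.target.vars

/-- The `i`-th argument of `o` is active if `x_i` is the left-hand side of a premise of a rule
of `o`. -/
def Active (o : S.Op) (i : Fin (S.arity o)) : Prop :=
  ∃ r ∈ L.rules o, ∃ k, r.lhs k = i

/-- The `i`-th argument of `o` is receiving if the target of some rule of the language has a
subterm `o(v_1, …, v_n)` such that the right-hand side of a premise of that rule occurs
in `v_i`. -/
def Receiving (o : S.Op) (i : Fin (S.arity o)) : Prop :=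
  ∃ o', ∃ r ∈ L.rules o', ∃ v : Fin (S.arity o) → Term S (Fin (S.arity o') ⊕ Fin r.npos),
    Term.Subterm (.op o v) r.target ∧ ∃ k : Fin r.npos, Sum.inr k ∈ (v i).vars

/-- The `i`-th argument of `o` has a patience rule. -/
def HasPatience (o : S.Op) (i : Fin (S.arity o)) : Prop :=
  GSOSRule.patience S A o i ∈ L.rules o

/-- The simply WB cool rule format. -/
structure SimplyWBCool : Prop where
  positive : L.Positive
  straight : ∀ o, L.Straight o
  tau_premise : ∀ o, ∀ r ∈ L.rules o, ∀ k, r.posLab k = none →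
    ∃ i, r = GSOSRule.patience S A o i
  active : ∀ o i, L.Active o i → L.HasPatience o i
  receiving : ∀ o i, L.Receiving o i → L.HasPatience o i
  smooth : ∀ o, L.Smooth o

end GSOSLanguage

/-! Positivity alone gives continuity: a transition of a term uses finitely many premises, so all of
them already hold at one stage of the chain.

Unitality and observability are two instances of `SimplyWBCool.weak_of_mem_lift`. For `η ∨ f` and
for `f ⋄ f`, every step of a variable is a weak `f`-step: some silent steps with at most one visible
step among them. The format propagates this to all terms by induction. A τ-premise occurs only in a
patience rule, which passes silent paths on to the context. Any other rule has visible premises,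
each met by a weak step `s i ⇒ b → c ⇒ y`. Patience of active arguments moves the arguments to the
`b`s, the rule then fires on the steps `b → c`, and patience of receiving arguments moves the `c`s
to the `y`s inside the target. Straightness makes the first phase possible, and smoothness keeps it
invisible in the target. Finally, weak transitions lie in the reflexive transitive closure. -/

namespace Term

variable {S : Signature.{u}}

/-! ### Substitution in terms. -/

theorem subst_subst {V : Type v} {W : Type w} {Z : Type*} (g : V → Term S W) (h : W → Term S Z)
    (t : Term S V) : (t.subst g).subst h = t.subst (fun x => (g x).subst h) := by
  induction t with
  | var x => rfl
  | op o args ih =>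
    simp only [subst]
    congr 1
    funext i
    exact ih i

theorem subst_var {V : Type v} (t : Term S V) : t.subst var = t := by
  induction t with
  | var x => rfl
  | op o args ih =>
    simp only [subst]
    congr 1
    funext i
    exact ih i

theorem join_map {V : Type v} {W : Type w} (g : V → Term S W) (t : Term S V) :
    (t.map g).join = t.subst g :=
  subst_subst _ _ t

theorem subst_congr {V : Type v} {W : Type w} {g h : V → Term S W} {t : Term S V}
    (H : ∀ x ∈ t.vars, g x = h x) : t.subst g = t.subst h := by
  induction t with
  | var x => exact H x rfl
  | op o args ih =>
    simp only [subst]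
    congr 1
    funext i
    exact ih i fun x hx => H x (Set.mem_iUnion.2 ⟨i, hx⟩)

end Term

/-! ### Silent paths, weak transitions and the reflexive transitive closure. -/

namespace Beh

variable {A X Y Z : Type u}

theorem mem_kcomp {g : Y → Beh A Z} {f : X → Beh A Y} {x : X} {δ : Option A} {z : Z} :
    (δ, z) ∈ (kcomp g f x).1 ↔
      ∃ δ₁ δ₂ y, (δ₁, y) ∈ (f x).1 ∧ (δ₂, z) ∈ (g y).1 ∧ δ ∈ labelMul δ₁ δ₂ := by
  constructor
  · rintro ⟨_, ⟨⟨δ₁, y⟩, hy, rfl⟩, ⟨δ₂, z'⟩, hz, hδ, rfl⟩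
    exact ⟨δ₁, δ₂, y, hy, hz, hδ⟩
  · rintro ⟨δ₁, δ₂, y, hy, hz, hδ⟩
    exact ⟨_, ⟨(δ₁, y), hy, rfl⟩, (δ₂, z), hz, hδ, rfl⟩

theorem mem_seqSup {f : ℕ → X → Beh A Y} {x : X} {p : Option A × Y} :
    p ∈ (seqSup f x).1 ↔ ∃ n, p ∈ (f n x).1 :=
  Set.mem_iUnion

/-- A finite sequence of silent steps. -/
def Silent (f : X → Beh A X) : X → X → Prop :=
  Relation.ReflTransGen fun x y => (none, y) ∈ (f x).1

/-- Weak transitions: a visible step may be preceded and followed by silent steps, and a weak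
silent step is a finite sequence of silent steps. -/
def Weak (f : X → Beh A X) : Option A → X → X → Prop
  | none, x, y => Silent f x y
  | some a, x, y => ∃ x' y', Silent f x x' ∧ (some a, y') ∈ (f x').1 ∧ Silent f y' y

theorem Weak.head {f : X → Beh A X} {δ : Option A} {x y z : X} (h : (none, y) ∈ (f x).1)
    (H : Weak f δ y z) : Weak f δ x z := by
  cases δ with
  | none => exact Relation.ReflTransGen.head h H
  | some a =>
    obtain ⟨y', z', h₁, h₂, h₃⟩ := H
    exact ⟨y', z', .head h h₁, h₂, h₃⟩

/-- The label product is empty on two visible labels, so at least one of the two steps is silent and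
is absorbed by the other. This handles the two-step transitions of `f ⋄ f`. -/
theorem Weak.of_labelMul {f : X → Beh A X} {δ δ₁ δ₂ : Option A} {x y z : X}
    (h : (δ₁, y) ∈ (f x).1) (H : Weak f δ₂ y z) (hδ : δ ∈ labelMul δ₁ δ₂) : Weak f δ x z := by
  rcases δ₁ with _ | a
  · have : δ = δ₂ := by cases δ₂ <;> exact hδ
    subst this
    exact H.head h
  · rcases δ₂ with _ | b
    · obtain rfl : δ = some a := hδ
      exact ⟨x, y, .refl, h, H⟩
    · exact hδ.elim

theorem Weak.single {f : X → Beh A X} {δ : Option A} {x y : X} (h : (δ, y) ∈ (f x).1) :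
    Weak f δ x y := by
  cases δ with
  | none => exact Relation.ReflTransGen.single h
  | some a => exact ⟨x, y, .refl, h, .refl⟩

theorem Weak.trans_silent {f : X → Beh A X} {δ : Option A} {x y z : X} (h : Weak f δ x y)
    (H : Silent f y z) : Weak f δ x z := by
  cases δ with
  | none => exact Relation.ReflTransGen.trans h H
  | some a =>
    obtain ⟨x', y', h₁, h₂, h₃⟩ := h
    exact ⟨x', y', h₁, h₂, h₃.trans H⟩

theorem Silent.trans_weak {f : X → Beh A X} {δ : Option A} {x y z : X} (h : Silent f x y)
    (H : Weak f δ y z) : Weak f δ x z := by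
  induction h using Relation.ReflTransGen.head_induction_on with
  | refl => exact H
  | head h _ ih => exact ih.head h

theorem mem_rtClosure_refl (f : X → Beh A X) (x : X) : (none, x) ∈ (rtClosure f x).1 :=
  mem_seqSup.2 ⟨0, rfl⟩

theorem mem_rtClosure_head {f : X → Beh A X} {δ δ₁ δ₂ : Option A} {x y z : X}
    (h : (δ₁, y) ∈ (f x).1) (H : (δ₂, z) ∈ (rtClosure f y).1) (hδ : δ ∈ labelMul δ₁ δ₂) :
    (δ, z) ∈ (rtClosure f x).1 := by
  obtain ⟨n, hn⟩ := mem_seqSup.1 H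
  -- `kpow` performs its extra factor first, so prefixing one step turns the `n`-th power into the
  -- next; `Or.inr` picks `f` in `eta ⊔ f`.
  exact mem_seqSup.2 ⟨n + 1, mem_kcomp.2 ⟨δ₁, δ₂, y, Or.inr h, hn, hδ⟩⟩

theorem mem_rtClosure_of_silent {f : X → Beh A X} {δ : Option A} {x y z : X}
    (h : Silent f x y) (H : (δ, z) ∈ (rtClosure f y).1) : (δ, z) ∈ (rtClosure f x).1 := by
  induction h using Relation.ReflTransGen.head_induction_on with
  | refl => exact H
  | head h _ ih => exact mem_rtClosure_head h ih (by cases δ <;> rfl)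

/-- The reflexive transitive closure contains the weak transitions. -/
theorem mem_rtClosure_of_weak {f : X → Beh A X} {δ : Option A} {x y : X} (h : Weak f δ x y) :
    (δ, y) ∈ (rtClosure f x).1 := by
  cases δ with
  | none => exact mem_rtClosure_of_silent h (mem_rtClosure_refl f y)
  | some a =>
    obtain ⟨x', y', h₁, h₂, h₃⟩ := h
    exact mem_rtClosure_of_silent h₁ (mem_rtClosure_head h₂
      (mem_rtClosure_of_silent h₃ (mem_rtClosure_refl f y)) rfl)

end Beh

/-! ### Transitions of composite terms, monotonicity and continuity. -/

namespace GSOSLanguage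

variable {S : Signature.{u}} {A X : Type u} {L : GSOSLanguage S A} {f g : X → Beh A X}

open Beh

theorem mem_lift_var {x : X} {δ : Option A} {t : Term S X} :
    (δ, t) ∈ (L.law.lift f (.var x)).1 ↔ ∃ y, (δ, y) ∈ (f x).1 ∧ t = .var y := by
  constructor
  · rintro ⟨⟨δ', y⟩, hy, h⟩
    obtain ⟨rfl, rfl⟩ := Prod.mk.inj h
    exact ⟨y, hy, rfl⟩
  · rintro ⟨y, hy, rfl⟩
    exact ⟨(δ, y), hy, rfl⟩

theorem lift_op (o : S.Op) (s : Fin (S.arity o) → Term S X) :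
    L.law.lift f (.op o s) =
      (L.law.rho ⟨o, fun i => (s i, L.law.lift f (s i))⟩).map Term.join := by
  have h : ∀ i, ((s i).map fun x => (x, f x)).map Prod.fst = s i := fun i => by
    rw [Term.map_map]
    exact Term.subst_var (s i)
  change (L.law.rho ⟨o, fun i => (((s i).map fun x => (x, f x)).map Prod.fst,
    L.law.lift f (s i))⟩).map Term.join = _
  simp only [h]

/-- The transitions of a composite term under a positive language. -/
theorem mem_lift_op (hL : L.Positive) {o : S.Op} {s : Fin (S.arity o) → Term S X}
    {δ : Option A} {t : Term S X} :
    (δ, t) ∈ (L.law.lift f (.op o s)).1 ↔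
      ∃ r ∈ L.rules o, ∃ y : Fin r.npos → Term S X,
        (∀ k, (r.posLab k, y k) ∈ (L.law.lift f (s (r.posArg k))).1) ∧
        δ = r.act ∧ t = r.target.subst (Sum.elim s y) := by
  rw [lift_op]
  constructor
  · rintro ⟨_, ⟨r, hr, y, hy, -, rfl⟩, h⟩
    obtain ⟨rfl, rfl⟩ := Prod.mk.inj h
    exact ⟨r, hr, y, hy, rfl, Term.join_map _ _⟩
  · rintro ⟨r, hr, y, hy, rfl, rfl⟩
    refine ⟨_, ⟨r, hr, y, hy, fun k => ?_, rfl⟩, Prod.ext rfl (Term.join_map _ _)⟩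
    exact (Fin.cast (hL o r hr) k).elim0

/-- Without negative premises, additional transitions of the arguments never disable a rule. -/
theorem lift_mono (hL : L.Positive) (h : f ≤ g) : L.law.lift f ≤ L.law.lift g := by
  intro t
  induction t with
  | var x =>
    rintro ⟨δ, t⟩ ht
    obtain ⟨y, hy, rfl⟩ := mem_lift_var.1 ht
    exact mem_lift_var.2 ⟨y, h x hy, rfl⟩
  | op o s ih =>
    rintro ⟨δ, t⟩ ht
    obtain ⟨r, hr, y, hy, rfl, rfl⟩ := (mem_lift_op hL).1 ht
    exact (mem_lift_op hL).2 ⟨r, hr, y, fun k => ih _ (hy k), rfl, rfl⟩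

/-- The law of a positive language is continuous. -/
theorem Positive.continuity (hL : L.Positive) : L.law.Continuity := by
  intro X f hf
  refine le_antisymm ?_ ?_
  · intro t
    induction t with
    | var x =>
      rintro ⟨δ, t⟩ ht
      obtain ⟨y, hy, rfl⟩ := mem_lift_var.1 ht
      obtain ⟨n, hn⟩ := mem_seqSup.1 hy
      exact mem_seqSup.2 ⟨n, mem_lift_var.2 ⟨y, hn, rfl⟩⟩
    | op o s ih =>
      rintro ⟨δ, t⟩ ht
      obtain ⟨r, hr, y, hy, rfl, rfl⟩ := (mem_lift_op hL).1 ht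
      choose n hn using fun k => mem_seqSup.1 (ih _ (hy k))
      -- Premise `k` holds from stage `n k` on; the maximum over the finitely many premises serves
      -- them all because the chain ascends.
      refine mem_seqSup.2 ⟨Finset.univ.sup n,
        (mem_lift_op hL).2 ⟨r, hr, y, fun k => ?_, rfl, rfl⟩⟩
      exact lift_mono hL (hf (Finset.le_sup (Finset.mem_univ k))) _ (hn k)
  · refine (isLUB_seqSup _).2 ?_
    rintro _ ⟨n, rfl⟩
    exact lift_mono hL ((isLUB_seqSup f).1 ⟨n, rfl⟩)

/-! ### Patience: silent paths inside contexts. -/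

theorem patience_subst {o : S.Op} (i : Fin (S.arity o)) (s : Fin (S.arity o) → Term S X)
    (y : Fin (GSOSRule.patience S A o i).npos → Term S X) :
    (GSOSRule.patience S A o i).target.subst (Sum.elim s y) =
      .op o (Function.update s i (y (0 : Fin 1))) := by
  change Term.op o (fun j => Term.subst (Sum.elim s y)
    (if j = i then Term.var (Sum.inr (0 : Fin 1)) else Term.var (Sum.inl j))) = _
  congr 1
  funext j
  by_cases hj : j = i
  · subst hj
    rw [if_pos rfl, Function.update_self]
    rfl
  · rw [if_neg hj, Function.update_of_ne hj]
    rfl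

/-- Silent steps of an argument with a patience rule are silent steps of the composite term. -/
theorem HasPatience.silent_update (hL : L.Positive) {o : S.Op} {i : Fin (S.arity o)}
    (hi : L.HasPatience o i) (s : Fin (S.arity o) → Term S X) {t t' : Term S X}
    (h : Silent (L.law.lift f) t t') :
    Silent (L.law.lift f) (.op o (Function.update s i t)) (.op o (Function.update s i t')) := by
  induction h with
  | refl => exact .refl
  | @tail b c _ hbc ih =>
    refine ih.tail ((mem_lift_op hL).2 ⟨_, hi, fun _ => c, fun k => ?_, rfl, ?_⟩)
    · change (none, c) ∈ (L.law.lift f (Function.update s i b i)).1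
      rwa [Function.update_self]
    · rw [patience_subst, Function.update_idem]

/-- The arguments can be moved one after another, since a patience step changes only its own
argument. An argument that stays put needs no patience rule. -/
theorem silent_op (hL : L.Positive) {o : S.Op} {s s' : Fin (S.arity o) → Term S X}
    (h : ∀ i, s i = s' i ∨ L.HasPatience o i ∧ Silent (L.law.lift f) (s i) (s' i)) :
    Silent (L.law.lift f) (.op o s) (.op o s') := by
  -- `F` is the set of arguments already moved.
  have key : ∀ F : Finset (Fin (S.arity o)),
      Silent (L.law.lift f) (.op o s) (.op o (F.piecewise s' s)) := by
    intro F
    induction F using Finset.induction_on with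
    | empty =>
      rw [Finset.piecewise_empty]
      exact .refl
    | insert i F hi ih =>
      rw [Finset.piecewise_insert]
      refine ih.trans ?_
      have hs : F.piecewise s' s = Function.update (F.piecewise s' s) i (s i) := by
        rw [← Finset.piecewise_eq_of_notMem F s' s hi, Function.update_eq_self]
      rcases h i with he | ⟨hp, hsil⟩
      · rw [← he, ← hs]
      · have := hp.silent_update hL (F.piecewise s' s) hsil
        rwa [← hs] at this
  have := key Finset.univ
  rwa [Finset.piecewise_univ] at this

/-- Silent steps of substituted terms are silent steps of the whole term when patience rules
are available above the variables that move. -/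
theorem silent_subst (hL : L.Positive) {V : Type v} {g h : V → Term S X} (t : Term S V)
    (hgh : ∀ x, Silent (L.law.lift f) (g x) (h x))
    (ht : ∀ o (w : Fin (S.arity o) → Term S V), Term.Subterm (.op o w) t →
      ∀ i, ∀ x ∈ (w i).vars, g x ≠ h x → L.HasPatience o i) :
    Silent (L.law.lift f) (t.subst g) (t.subst h) := by
  induction t with
  | var x => exact hgh x
  | op o w ih =>
    refine silent_op hL fun i => ?_
    -- Patience at argument `i` is available only if some variable below it really moves; otherwise
    -- the two substituted arguments coincide.
    by_cases H : ∀ x ∈ (w i).vars, g x = h x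
    · exact Or.inl (Term.subst_congr H)
    · push Not at H
      obtain ⟨x, hx, hne⟩ := H
      exact Or.inr ⟨ht o w .refl i x hx hne,
        ih i fun o' w' hs => ht o' w' (.arg o w i hs)⟩

/-! ### Weak transitions of terms; unitality and observability. -/

/-- For a simply WB cool language, if all transitions of variables under `g` are weak transitions
under `f`, then so are all transitions of terms. -/
theorem SimplyWBCool.weak_of_mem_lift (hL : L.SimplyWBCool)
    (hg : ∀ x δ y, (δ, y) ∈ (g x).1 → Weak (L.law.lift f) δ (.var x) (.var y))
    {t t' : Term S X} {δ : Option A} (ht : (δ, t') ∈ (L.law.lift g t).1) :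
    Weak (L.law.lift f) δ t t' := by
  induction t generalizing δ t' with
  | var x =>
    obtain ⟨y, hy, rfl⟩ := mem_lift_var.1 ht
    exact hg x δ y hy
  | op o s ih =>
    obtain ⟨r, hr, y, hy, rfl, rfl⟩ := (mem_lift_op hL.positive).1 ht
    have hw := fun k => ih _ (hy k)
    by_cases hτ : ∃ k, r.posLab k = none
    · obtain ⟨k, hk⟩ := hτ
      obtain ⟨i, rfl⟩ := hL.tau_premise o r hr k hk
      rw [patience_subst i s y]
      -- The only premise of a patience rule is labelled `τ`, so its weak transition is just a
      -- silent path.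
      have := HasPatience.silent_update hL.positive hr s (hw (0 : Fin 1))
      rwa [show (GSOSRule.patience S A o i).posArg (0 : Fin 1) = i from rfl,
        Function.update_eq_self] at this
    · have hvis : ∀ k, ∃ a, r.posLab k = some a := fun k =>
        Option.ne_none_iff_exists'.1 fun h => hτ ⟨k, h⟩
      choose a ha using hvis
      -- Each weak visible step splits as `s (posArg k) ⇒ b k → c k ⇒ y k`, with the visible step in
      -- the middle.
      simp only [ha, Weak] at hw
      choose b c hb hbc hc using hw
      -- By straightness no argument is tested twice, so it never has to reach two different states
      -- `b k`, and `Function.extend` has the value `b k` at `posArg k`.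
      have hinj : Function.Injective r.posArg := fun k l hkl =>
        Sum.inl_injective (hL.straight o r hr (a₁ := Sum.inl k) (a₂ := Sum.inl l) hkl)
      have hbefore : Silent (L.law.lift f) (.op o s) (.op o (Function.extend r.posArg b s)) := by
        refine silent_op hL.positive fun i => ?_
        by_cases hi : ∃ k, r.posArg k = i
        · obtain ⟨k, rfl⟩ := hi
          rw [hinj.extend_apply]
          exact Or.inr ⟨hL.active o _ ⟨r, hr, Sum.inl k, rfl⟩, hb k⟩
        · exact Or.inl (Function.extend_apply' _ _ _ hi).symm
      have hstep : (r.act, r.target.subst (Sum.elim s c)) ∈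
          (L.law.lift f (.op o (Function.extend r.posArg b s))).1 := by
        refine (mem_lift_op hL.positive).2 ⟨r, hr, c, fun k => ?_, rfl, ?_⟩
        · rw [hinj.extend_apply, ha]
          exact hbc k
        -- The rule fires on the moved arguments, yet its target may be instantiated with the
        -- original ones: the two differ only at tested arguments, which by smoothness do not occur
        -- in the target.
        · refine Term.subst_congr ?_
          rintro (i | k) hx
          · refine (Function.extend_apply' b s i ?_).symm
            rintro ⟨k, rfl⟩
            exact (hL.smooth o).2 r hr (Sum.inl k) hx
          · rfl
      -- Only the variables `y_k` move. Every argument position above an occurrence of one is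
      -- receiving, hence patient, however deep or often it occurs.
      have hafter : Silent (L.law.lift f) (r.target.subst (Sum.elim s c))
          (r.target.subst (Sum.elim s y)) := by
        refine silent_subst hL.positive _ ?_ ?_
        · rintro (i | k)
          · exact .refl
          · exact hc k
        · rintro o' w hsub i (j | k) hx hne
          · exact (hne rfl).elim
          · exact hL.receiving o' i ⟨o, r, hr, w, hsub, k, hx⟩
      exact hbefore.trans_weak ((Weak.single hstep).trans_silent hafter)

theorem SimplyWBCool.unitality (hL : L.SimplyWBCool) : L.law.Unitality := by
  rintro X f t ⟨δ, t'⟩ ht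
  refine mem_rtClosure_of_weak (hL.weak_of_mem_lift ?_ ht)
  rintro x δ y (hy | hy)
  · obtain ⟨rfl, rfl⟩ := Prod.mk.inj hy
    -- The step added by `eta` is a silent loop at the variable, matched by the empty silent path.
    exact Relation.ReflTransGen.refl
  · exact .single (mem_lift_var.2 ⟨y, hy, rfl⟩)

theorem SimplyWBCool.observability (hL : L.SimplyWBCool) : L.law.Observability := by
  rintro X f t ⟨δ, t'⟩ ht
  refine mem_rtClosure_of_weak (hL.weak_of_mem_lift ?_ ht)
  intro x δ z hz
  obtain ⟨δ₁, δ₂, y, hy, hz, hδ⟩ := mem_kcomp.1 hz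
  exact .of_labelMul (mem_lift_var.2 ⟨y, hy, rfl⟩) (.single (mem_lift_var.2 ⟨z, hz, rfl⟩)) hδ

end GSOSLanguage

theorem theorem3p7 {S : Signature.{u}} {A : Type u} (L : GSOSLanguage S A)
    (hL : L.SimplyWBCool) :
    L.law.Continuity ∧ L.law.Unitality ∧ L.law.Observability :=
  ⟨hL.positive.continuity, hL.unitality, hL.observability⟩
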